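/- Units with $\kappa_G=c=1$. In conformal Killing gravity (CKG) the field equations are $R_{kl}-\tfrac12 R\,g_{kl}=T_{kl}+K_{kl}$, where $K_{kl}$ is a symmetric tensor satisfying the conformal Killing equation $$\nabla_jK_{kl}+\nabla_kK_{jl}+\nabla_lK_{jk}=\tfrac16\left(g_{kl}\nabla_jK+g_{jl}\nabla_kK+g_{jk}\nabla_lK\right),\qquad K=g^{kl}K_{kl}$$ (which in four dimensions implies $\nabla^kK_{kl}=0$). For a static spherical metric let $u$ be the velocity of the static observers and $\chi$ the outward radial unit covector. We consider $K_{kl}=A(r)u_ku_l+B(r)g_{kl}+C(r)\chi_k\chi_l$; its radial pressure (the radial dark pressure) is $p_{dr}=B+C$. Let $0<R<R_1$. Interior. On $0<r<R$ let $ds_-^2=-b_-^2(r)\,dt^2+\left[1-\tfrac{2M(r)}{r}\right]^{-1}dr^2+r^2d\Omega_2^2$ be a solution of the CKG field equations with such a tensor $K^-$ (coefficients $A^-,B^-,C^-$) and with the anisotropic fluid source $$T_{kl}=(\mu_m+P_m)u_ku_l+P_m\,g_{kl}+(p_{mr}-p_{m\perp})\left[\chi_k\chi_l-\tfrac13(g_{kl}+u_ku_l)\right],\qquad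 P_m=\tfrac13(p_{mr}+2p_{m\perp}),$$ where $b_-,M$ are $C^2$, $A^-,B^-,C^-$ are $C^1$ and $p_{mr}$ is continuous on $(0,R]$, and $b_-\neq0$ and $1-2M(r)/r>0$ there. Exterior. On $R<r<R_1$ let $ds_+^2=-b_+^2(r)\,dt^2+f_{1+}^2(r)\,dr^2+r^2d\Omega_2^2$ be a vacuum solution ($T_{kl}=0$) of the CKG field equations with such a tensor $K^+$ (coefficients $A^+,B^+,C^+$), where $b_+,f_{1+}$ are $C^2$ and nowhere zero and $A^+,B^+,C^+$ are $C^1$ on $[R,R_1)$. The junction conditions at $r=R$ are the continuity of the metric $g_{kl}$ and of the extrinsic curvature $\nabla_k\chi_l$ of the spheres $r=\mathrm{const}$, meaning that all components have equal one-sided limits as $r\to R^-$ and $r\to R^+$. Then: 1. The metric is continuous at $r=R$ if and only if $$b_-^2(R)=b_+^2(R)\qquad\text{and}\qquad 1-\frac{2M(R)}{R}=\frac1{f_{1+}^2(R)}.$$ 2. If the metric is continuous at $r=R$, then the extrinsic curvature is continuous at $r=R$ if and only if $$p_{mr}(R)=p_{dr}^+(R)-p_{dr}^-(R).$$ 3.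 Here the dark pressures are the functions $p_{dr}^\pm(r)=\kappa_1^\pm+\kappa_2^\pm r^2+\kappa_3^\pm b_\pm^2(r)$, for some real constants $\kappa_1^\pm,\kappa_2^\pm,\kappa_3^\pm$, on $(0,R]$ for the sign $-$ and on $[R,R_1)$ for the sign $+$. -/

import Mathlib

open Filter Topology Set

noncomputable section

namespace CKG

/-! Coordinates on space-time are `x = (t, r, θ, φ)`, that is `x 0, x 1, x 2, x 3`.
Tensor fields are given by their coordinate components. -/

/-- The partial derivative `∂ᵢ F` in the `i`-th coordinate. -/
def pd (i : Fin 4) (F : (Fin 4 → ℝ) → ℝ) (x : Fin 4 → ℝ) : ℝ :=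
  deriv (fun s => F (Function.update x i s)) (x i)

/-- A covariant 2-tensor field in coordinates. -/
abbrev Tensor2 : Type := (Fin 4 → ℝ) → Matrix (Fin 4) (Fin 4) ℝ

/-- Christoffel symbol `Γᵐ_{ij} = ½ g^{mn} (∂ᵢ g_{nj} + ∂ⱼ g_{ni} - ∂ₙ g_{ij})`. -/
def christoffel (g : Tensor2) (m i j : Fin 4) (x : Fin 4 → ℝ) : ℝ :=
  (1 / 2) * ∑ n, (g x)⁻¹ m n *
    (pd i (fun z => g z n j) x + pd j (fun z => g z n i) x - pd n (fun z => g z i j) x)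

/-- Ricci tensor
`R_{kl} = ∂ₘ Γᵐ_{kl} - ∂ₗ Γᵐ_{mk} + Γᵐ_{mn} Γⁿ_{kl} - Γᵐ_{ln} Γⁿ_{mk}`. -/
def ricci (g : Tensor2) (k l : Fin 4) (x : Fin 4 → ℝ) : ℝ :=
  (∑ m, pd m (christoffel g m k l) x) - (∑ m, pd l (christoffel g m m k) x)
    + (∑ m, ∑ n, christoffel g m m n x * christoffel g n k l x)
    - (∑ m, ∑ n, christoffel g m l n x * christoffel g n m k x)

/-- Metric trace `g^{kl} S_{kl}`. -/
def metricTrace (g S : Tensor2) (x : Fin 4 → ℝ) : ℝ :=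
  ∑ k, ∑ l, (g x)⁻¹ k l * S x k l

/-- Einstein tensor `R_{kl} - ½ R g_{kl}`. -/
def einstein (g : Tensor2) : Tensor2 := fun x k l =>
  ricci g k l x - (1 / 2) * metricTrace g (fun z i j => ricci g i j z) x * g x k l

/-- Covariant derivative of a covector field, `∇ₖ χₗ = ∂ₖ χₗ - Γᵐ_{kl} χₘ`. -/
def covDeriv1 (g : Tensor2) (χ : (Fin 4 → ℝ) → Fin 4 → ℝ) : Tensor2 := fun x k l =>
  pd k (fun z => χ z l) x - ∑ m, christoffel g m k l x * χ x m

/-- Covariant derivative of a 2-tensor field,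
`∇ⱼ S_{kl} = ∂ⱼ S_{kl} - Γᵐ_{jk} S_{ml} - Γᵐ_{jl} S_{km}`. -/
def covDeriv2 (g S : Tensor2) (j k l : Fin 4) (x : Fin 4 → ℝ) : ℝ :=
  pd j (fun z => S z k l) x - (∑ m, christoffel g m j k x * S x m l)
    - (∑ m, christoffel g m j l x * S x k m)

/-- The conformal Killing equation with trace factor `1/6` at the point `x`. In four dimensions
its contraction with `g^{kl}` reads `∇ᵏ S_{kj} = 0`, so it contains the conservation law. -/
def ConformalKillingAt (g S : Tensor2) (x : Fin 4 → ℝ) : Prop :=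
  ∀ j k l, covDeriv2 g S j k l x + covDeriv2 g S k j l x + covDeriv2 g S l j k x =
    (1 / 6) * (g x k l * pd j (metricTrace g S) x + g x j l * pd k (metricTrace g S) x
      + g x j k * pd l (metricTrace g S) x)

/-- The static spherical metric `-y(r) dt² + w(r) dr² + r² (dθ² + sin² θ dφ²)`. -/
def metric (y w : ℝ → ℝ) : Tensor2 := fun x =>
  Matrix.diagonal ![-y (x 1), w (x 1), x 1 ^ 2, x 1 ^ 2 * Real.sin (x 2) ^ 2]

/-- The velocity covector of the static observers, `u = -√y dt`. -/
def velocity (y : ℝ → ℝ) : (Fin 4 → ℝ) → Fin 4 → ℝ := fun x =>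
  ![-√(y (x 1)), 0, 0, 0]

/-- The outward unit conormal of the spheres `r = const`, `χ = √w dr`. -/
def normal (w : ℝ → ℝ) : (Fin 4 → ℝ) → Fin 4 → ℝ := fun x =>
  ![0, √(w (x 1)), 0, 0]

/-- The anisotropic fluid tensor with density `μ`, radial pressure `pr`, transverse pressure `pt`:
`(μ + P) uₖ uₗ + P g_{kl} + (pr - pt) (χₖ χₗ - (g_{kl} + uₖ uₗ) / 3)`, with
`P = (pr + 2 pt) / 3`. -/
def fluidTensor (y w μ pr pt : ℝ → ℝ) : Tensor2 := fun x k l =>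
  let P := (pr (x 1) + 2 * pt (x 1)) / 3
  (μ (x 1) + P) * velocity y x k * velocity y x l + P * metric y w x k l
    + (pr (x 1) - pt (x 1)) *
      (normal w x k * normal w x l - (metric y w x k l + velocity y x k * velocity y x l) / 3)

/-- The dark tensor `K_{kl} = A(r) uₖ uₗ + B(r) g_{kl} + C(r) χₖ χₗ`. -/
def darkTensor (y w A B C : ℝ → ℝ) : Tensor2 := fun x k l =>
  A (x 1) * velocity y x k * velocity y x l + B (x 1) * metric y w x k l
    + C (x 1) * normal w x k * normal w x l

/-- The radial pressure `B + C` of the dark tensor: written as an anisotropic fluid, `darkTensor`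
has density `A - B`, radial pressure `B + C` and transverse pressure `B`. -/
def darkRadialPressure (B C : ℝ → ℝ) (r : ℝ) : ℝ := B r + C r

/-- The coordinate domain over the radial interval `I` (the axis of the angles is left out). -/
def region (I : Set ℝ) : Set (Fin 4 → ℝ) :=
  {x | x 1 ∈ I ∧ x 2 ∈ Ioo 0 Real.pi}

/-- Radial coefficient `(1 - 2 M(r) / r)⁻¹` of the interior metric. -/
def massCoeff (M : ℝ → ℝ) (r : ℝ) : ℝ := (1 - 2 * M r / r)⁻¹

/-- Interior metric `-b² dt² + (1 - 2 M / r)⁻¹ dr² + r² dΩ²`. -/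
def interiorMetric (b M : ℝ → ℝ) : Tensor2 := metric (fun r => b r ^ 2) (massCoeff M)

/-- Exterior metric `-b² dt² + f² dr² + r² dΩ²`. -/
def exteriorMetric (b f : ℝ → ℝ) : Tensor2 := metric (fun r => b r ^ 2) (fun r => f r ^ 2)

/-- A static sphere `0 < r < R` of anisotropic fluid in conformal Killing gravity (`κ_G = 1`):
`G = T + K` with `T` the fluid tensor and `K` a conformal Killing tensor of the anisotropic form.
The metric functions, the radial pressure and `K` are regular up to the surface `r = R` from
inside. -/
structure IsFluidSphere (R : ℝ) (b M μ pr pt A B C : ℝ → ℝ) : Prop where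
  b_smooth : ContDiffOn ℝ 2 b (Ioc 0 R)
  M_smooth : ContDiffOn ℝ 2 M (Ioc 0 R)
  b_ne : ∀ r ∈ Ioc 0 R, b r ≠ 0
  M_lt : ∀ r ∈ Ioc 0 R, 0 < 1 - 2 * M r / r
  pr_cont : ContinuousOn pr (Ioc 0 R)
  A_smooth : ContDiffOn ℝ 1 A (Ioc 0 R)
  B_smooth : ContDiffOn ℝ 1 B (Ioc 0 R)
  C_smooth : ContDiffOn ℝ 1 C (Ioc 0 R)
  killing : ∀ x ∈ region (Ioo 0 R),
    ConformalKillingAt (interiorMetric b M)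
      (darkTensor (fun r => b r ^ 2) (massCoeff M) A B C) x
  field : ∀ x ∈ region (Ioo 0 R),
    einstein (interiorMetric b M) x =
      fluidTensor (fun r => b r ^ 2) (massCoeff M) μ pr pt x
        + darkTensor (fun r => b r ^ 2) (massCoeff M) A B C x

/-- A static spherical vacuum `R < r < R₁` of conformal Killing gravity: `G = K` with `K` a
conformal Killing tensor of the anisotropic form.
The metric functions and `K` are regular up to the surface `r = R` from outside. -/
structure IsVacuumExterior (R R₁ : ℝ) (b f A B C : ℝ → ℝ) : Prop where
  b_smooth : ContDiffOn ℝ 2 b (Ico R R₁)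
  f_smooth : ContDiffOn ℝ 2 f (Ico R R₁)
  b_ne : ∀ r ∈ Ico R R₁, b r ≠ 0
  f_ne : ∀ r ∈ Ico R R₁, f r ≠ 0
  A_smooth : ContDiffOn ℝ 1 A (Ico R R₁)
  B_smooth : ContDiffOn ℝ 1 B (Ico R R₁)
  C_smooth : ContDiffOn ℝ 1 C (Ico R R₁)
  killing : ∀ x ∈ region (Ioo R R₁),
    ConformalKillingAt (exteriorMetric b f)
      (darkTensor (fun r => b r ^ 2) (fun r => f r ^ 2) A B C) x
  field : ∀ x ∈ region (Ioo R R₁),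
    einstein (exteriorMetric b f) x =
      darkTensor (fun r => b r ^ 2) (fun r => f r ^ 2) A B C x

/-- `S` on `r < R` and `S'` on `r > R` join continuously at `r = R`: at every point of the
hypersurface each component has the same limit from the two sides. -/
def ContinuousAcross (R : ℝ) (S S' : Tensor2) : Prop :=
  ∀ x : Fin 4 → ℝ, x ∈ region {R} → ∀ k l, ∃ c : ℝ,
    Tendsto (fun s => S (Function.update x 1 s) k l) (𝓝[<] R) (𝓝 c) ∧
    Tendsto (fun s => S' (Function.update x 1 s) k l) (𝓝[>] R) (𝓝 c)

/-- Continuity of the metric across `r = R`. -/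
def MetricContinuous (R : ℝ) (bi M be f : ℝ → ℝ) : Prop :=
  ContinuousAcross R (interiorMetric bi M) (exteriorMetric be f)

/-- Continuity across `r = R` of the extrinsic curvature `∇ₖ χₗ` of the spheres `r = const`. -/
def ExtrinsicCurvatureContinuous (R : ℝ) (bi M be f : ℝ → ℝ) : Prop :=
  ContinuousAcross R
    (covDeriv1 (interiorMetric bi M) (normal (massCoeff M)))
    (covDeriv1 (exteriorMetric be f) (normal (fun r => f r ^ 2)))

end CKG

end

/-!
For a metric `-y(r) dt² + w(r) dr² + r² dΩ²` all second derivatives cancel in the component `G_{rr}`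
of the Einstein tensor, and the radial field equation is of first order (`einstein_one_one`):
`y' / (r y w) + (1 / w - 1) / r² = (total radial pressure)`,
where the total radial pressure is `p_{dr}` in the vacuum and `p_{mr} + p_{dr}` in the fluid
(`radial_field_vacuum`, `radial_field_fluid`). All functions in this equation have limits at the
junction (`radial_field_limit`).

Apart from quantities that are continuous together with the metric, the extrinsic curvature
`∇ₖ χₗ` of the spheres contains only `y'`, in its `tt` component `-y' / (2 √w)` (`covDeriv1_normal`).
So, once the metric is continuous, it is continuous if and only if `y'` is, and by the limits of the
two radial field equations this happens if and only if the total radial pressure is continuous.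
The field equations thus enter only through their `rr` component.

The form of the dark pressure comes from three components of the conformal Killing equation for
`A u u + B g + C χ χ` (`killing_components`). They make `C / r²`, `(A + C) / y` and
`2 (B + C) + (A + C) + 2 C` constant on the open interval, hence by continuity also at the junction
radius, and `B + C` is a linear combination of `1`, `r²` and `y` (`darkRadialPressure_eq`).
-/

namespace CKG

/-! ### Coordinate derivatives -/

lemma pd_eq_of_hasDerivAt {i : Fin 4} {F : (Fin 4 → ℝ) → ℝ} {x : Fin 4 → ℝ} {F' : ℝ}
    (h : HasDerivAt (fun s => F (Function.update x i s)) F' (x i)) : pd i F x = F' :=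
  h.deriv

lemma pd_const (i : Fin 4) (c : ℝ) (x : Fin 4 → ℝ) : pd i (fun _ => c) x = 0 := by
  simp [pd]

lemma pd_congr {i : Fin 4} {F G : (Fin 4 → ℝ) → ℝ} {x : Fin 4 → ℝ} (h : F =ᶠ[𝓝 x] G) :
    pd i F x = pd i G x := by
  have hc : Tendsto (fun s => Function.update x i s) (𝓝 (x i)) (𝓝 x) := by
    have : Continuous (fun s : ℝ => Function.update x i s) := by fun_prop
    simpa using this.tendsto (x i)
  exact EventuallyEq.deriv_eq (hc.eventually h)

lemma pd_one_radial (h : ℝ → ℝ) (x : Fin 4 → ℝ) : pd 1 (fun z => h (z 1)) x = deriv h (x 1) := by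
  simp [pd]

lemma pd_radial_of_ne {i : Fin 4} (hi : i ≠ 1) (h : ℝ → ℝ) (x : Fin 4 → ℝ) :
    pd i (fun z => h (z 1)) x = 0 := by
  simp [pd, Function.update_of_ne hi.symm]

/-! ### The Levi-Civita connection of a static spherical metric -/

/-- The metric coefficients `y` and `w` are positive and as smooth as the curvature requires on the
open set `I` of positive radii. -/
structure IsRegularOn (y w : ℝ → ℝ) (I : Set ℝ) : Prop where
  isOpen : IsOpen I
  pos : ∀ r ∈ I, 0 < r
  y_pos : ∀ r ∈ I, 0 < y r
  w_pos : ∀ r ∈ I, 0 < w r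
  y_smooth : ContDiffOn ℝ 2 y I
  w_smooth : ContDiffOn ℝ 1 w I

lemma IsRegularOn.y_diff {y w : ℝ → ℝ} {I : Set ℝ} (h : IsRegularOn y w I) {r : ℝ} (hr : r ∈ I) :
    DifferentiableAt ℝ y r :=
  (h.y_smooth.contDiffAt (h.isOpen.mem_nhds hr)).differentiableAt (by norm_num)

lemma IsRegularOn.w_diff {y w : ℝ → ℝ} {I : Set ℝ} (h : IsRegularOn y w I) {r : ℝ} (hr : r ∈ I) :
    DifferentiableAt ℝ w r :=
  (h.w_smooth.contDiffAt (h.isOpen.mem_nhds hr)).differentiableAt (by norm_num)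

lemma IsRegularOn.y_diff_deriv {y w : ℝ → ℝ} {I : Set ℝ} (h : IsRegularOn y w I) {r : ℝ}
    (hr : r ∈ I) : DifferentiableAt ℝ (deriv y) r :=
  ((h.y_smooth.deriv_of_isOpen (m := 1) h.isOpen (by norm_num)).contDiffAt
    (h.isOpen.mem_nhds hr)).differentiableAt (by norm_num)

lemma isOpen_region {I : Set ℝ} (hI : IsOpen I) : IsOpen (region I) :=
  (hI.preimage (continuous_apply 1)).inter (isOpen_Ioo.preimage (continuous_apply 2))

lemma sin_pos_of_mem_region {I : Set ℝ} {x : Fin 4 → ℝ} (hx : x ∈ region I) :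
    0 < Real.sin (x 2) :=
  Real.sin_pos_of_mem_Ioo hx.2

lemma metric_inv {y w : ℝ → ℝ} {x : Fin 4 → ℝ} (hy : y (x 1) ≠ 0) (hw : w (x 1) ≠ 0)
    (hr : x 1 ≠ 0) (hs : Real.sin (x 2) ≠ 0) :
    (metric y w x)⁻¹ = Matrix.diagonal
      ![-(y (x 1))⁻¹, (w (x 1))⁻¹, (x 1 ^ 2)⁻¹, (x 1 ^ 2 * Real.sin (x 2) ^ 2)⁻¹] := by
  apply Matrix.inv_eq_left_inv
  rw [metric, Matrix.diagonal_mul_diagonal, ← Matrix.diagonal_one]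
  congr 1
  funext i
  fin_cases i <;> simp <;> field_simp

/-- The partial derivatives of the components of a static spherical metric: the entry `i` lists the
derivatives of the diagonal in the `i`-th coordinate. -/
lemma pd_metric (y w : ℝ → ℝ) (i n j : Fin 4) (x : Fin 4 → ℝ) :
    pd i (fun z => metric y w z n j) x = Matrix.diagonal
      ((![0, ![-deriv y (x 1), deriv w (x 1), 2 * x 1, 2 * x 1 * Real.sin (x 2) ^ 2],
        ![0, 0, 0, x 1 ^ 2 * (2 * Real.sin (x 2) * Real.cos (x 2))], 0] :
          Fin 4 → Fin 4 → ℝ) i) n j := by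
  by_cases hnj : n = j
  · subst hnj
    simp only [metric, Matrix.diagonal_apply_eq]
    have h2 : HasDerivAt (fun s => x 1 ^ 2 * Real.sin s ^ 2)
        (x 1 ^ 2 * (2 * Real.sin (x 2) * Real.cos (x 2))) (x 2) := by
      have := (((Real.hasDerivAt_sin (x 2)).pow 2).const_mul (x 1 ^ 2))
      simpa using this
    fin_cases i <;> fin_cases n <;> simp [pd, h2.deriv]
  · simp [metric, Matrix.diagonal_apply_ne _ hnj, pd_const]

/-- The Christoffel symbols of a static spherical metric; the outer index is the upper one. -/
noncomputable def staticGamma (y w : ℝ → ℝ) (m i j : Fin 4) : (Fin 4 → ℝ) → ℝ := fun x =>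
  (![!![0, deriv y (x 1) / (2 * y (x 1)), 0, 0;
        deriv y (x 1) / (2 * y (x 1)), 0, 0, 0;
        0, 0, 0, 0;
        0, 0, 0, 0],
     !![deriv y (x 1) / (2 * w (x 1)), 0, 0, 0;
        0, deriv w (x 1) / (2 * w (x 1)), 0, 0;
        0, 0, -(x 1 / w (x 1)), 0;
        0, 0, 0, -(x 1 / w (x 1)) * Real.sin (x 2) ^ 2],
     !![0, 0, 0, 0;
        0, 0, (x 1)⁻¹, 0;
        0, (x 1)⁻¹, 0, 0;
        0, 0, 0, -(Real.sin (x 2) * Real.cos (x 2))],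
     !![0, 0, 0, 0;
        0, 0, 0, (x 1)⁻¹;
        0, 0, 0, Real.cos (x 2) / Real.sin (x 2);
        0, (x 1)⁻¹, Real.cos (x 2) / Real.sin (x 2), 0]] :
    Fin 4 → Matrix (Fin 4) (Fin 4) ℝ) m i j

lemma christoffel_metric {y w : ℝ → ℝ} {x : Fin 4 → ℝ} (hy : y (x 1) ≠ 0) (hw : w (x 1) ≠ 0)
    (hr : x 1 ≠ 0) (hs : Real.sin (x 2) ≠ 0) (m i j : Fin 4) :
    christoffel (metric y w) m i j x = staticGamma y w m i j x := by
  rw [christoffel, metric_inv hy hw hr hs,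
    Finset.sum_eq_single m (fun n _ hn => by simp [Matrix.diagonal_apply_ne _ hn.symm]) (by simp)]
  simp only [pd_metric, Matrix.diagonal_apply_eq]
  fin_cases m <;> fin_cases i <;> fin_cases j <;> simp [staticGamma, Matrix.diagonal] <;> field_simp

lemma IsRegularOn.christoffel_eq {y w : ℝ → ℝ} {I : Set ℝ} (h : IsRegularOn y w I)
    {x : Fin 4 → ℝ} (hx : x ∈ region I) (m i j : Fin 4) :
    christoffel (metric y w) m i j x = staticGamma y w m i j x :=
  christoffel_metric (h.y_pos _ hx.1).ne' (h.w_pos _ hx.1).ne' (h.pos _ hx.1).ne'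
    (sin_pos_of_mem_region hx).ne' m i j

/-! ### The radial component of the Einstein tensor -/

lemma IsRegularOn.pd_christoffel {y w : ℝ → ℝ} {I : Set ℝ} (h : IsRegularOn y w I)
    {x : Fin 4 → ℝ} (hx : x ∈ region I) (n m i j : Fin 4) :
    pd n (christoffel (metric y w) m i j) x = pd n (staticGamma y w m i j) x :=
  pd_congr (by
    filter_upwards [(isOpen_region h.isOpen).mem_nhds hx] with z hz
    exact h.christoffel_eq hz m i j)

lemma ricci_zero_zero {y w : ℝ → ℝ} {I : Set ℝ} (h : IsRegularOn y w I) {x : Fin 4 → ℝ}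
    (hx : x ∈ region I) :
    ricci (metric y w) 0 0 x = deriv (deriv y) (x 1) / (2 * w (x 1))
      - deriv y (x 1) * deriv w (x 1) / (4 * w (x 1) ^ 2)
      - deriv y (x 1) ^ 2 / (4 * y (x 1) * w (x 1)) + deriv y (x 1) / (x 1 * w (x 1)) := by
  have hy := (h.y_pos _ hx.1).ne'
  have hw := (h.w_pos _ hx.1).ne'
  have hr := (h.pos _ hx.1).ne'
  have h1 : deriv (fun r => deriv y r / (2 * w r)) (x 1) =
      (deriv (deriv y) (x 1) * (2 * w (x 1)) - deriv y (x 1) * (2 * deriv w (x 1))) /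
        (2 * w (x 1)) ^ 2 :=
    ((h.y_diff_deriv hx.1).hasDerivAt.div ((h.w_diff hx.1).hasDerivAt.const_mul 2)
      (by positivity)).deriv
  simp only [ricci, h.pd_christoffel hx, h.christoffel_eq hx, Fin.sum_univ_four]
  delta staticGamma
  simp [pd_const, pd_one_radial (fun r => deriv y r / (2 * w r)), h1]
  field_simp
  ring

lemma ricci_one_one {y w : ℝ → ℝ} {I : Set ℝ} (h : IsRegularOn y w I) {x : Fin 4 → ℝ}
    (hx : x ∈ region I) :
    ricci (metric y w) 1 1 x = -deriv (deriv y) (x 1) / (2 * y (x 1))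
      + deriv y (x 1) ^ 2 / (4 * y (x 1) ^ 2)
      + deriv y (x 1) * deriv w (x 1) / (4 * y (x 1) * w (x 1))
      + deriv w (x 1) / (x 1 * w (x 1)) := by
  have hy := (h.y_pos _ hx.1).ne'
  have hw := (h.w_pos _ hx.1).ne'
  have hr := (h.pos _ hx.1).ne'
  have h1 : deriv (fun r => deriv y r / (2 * y r)) (x 1) =
      (deriv (deriv y) (x 1) * (2 * y (x 1)) - deriv y (x 1) * (2 * deriv y (x 1))) /
        (2 * y (x 1)) ^ 2 :=
    ((h.y_diff_deriv hx.1).hasDerivAt.div ((h.y_diff hx.1).hasDerivAt.const_mul 2)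
      (by positivity)).deriv
  simp only [ricci, h.pd_christoffel hx, h.christoffel_eq hx, Fin.sum_univ_four]
  delta staticGamma
  simp [pd_const, pd_one_radial (fun r => deriv y r / (2 * y r)), h1,
    pd_one_radial (fun r => r⁻¹)]
  field_simp
  ring

lemma deriv_div_self {w : ℝ → ℝ} {r : ℝ} (hw : DifferentiableAt ℝ w r) (h : w r ≠ 0) :
    deriv (fun s => s / w s) r = (w r - r * deriv w r) / w r ^ 2 := by
  have h' := ((hasDerivAt_id' r).fun_div hw.hasDerivAt h).deriv
  rwa [one_mul] at h'

lemma ricci_two_two {y w : ℝ → ℝ} {I : Set ℝ} (h : IsRegularOn y w I) {x : Fin 4 → ℝ}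
    (hx : x ∈ region I) :
    ricci (metric y w) 2 2 x = 1 - 1 / w (x 1) + x 1 * deriv w (x 1) / (2 * w (x 1) ^ 2)
      - x 1 * deriv y (x 1) / (2 * y (x 1) * w (x 1)) := by
  have hy := (h.y_pos _ hx.1).ne'
  have hw := (h.w_pos _ hx.1).ne'
  have hr := (h.pos _ hx.1).ne'
  have hs := (sin_pos_of_mem_region hx).ne'
  have h1 : deriv (fun r => -(r / w r)) (x 1) =
      -((w (x 1) - x 1 * deriv w (x 1)) / w (x 1) ^ 2) := by
    rw [deriv.fun_neg, deriv_div_self (h.w_diff hx.1) hw]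
  have h2 : pd 2 (fun z => Real.cos (z 2) / Real.sin (z 2)) x =
      (-Real.sin (x 2) * Real.sin (x 2) - Real.cos (x 2) * Real.cos (x 2)) /
        Real.sin (x 2) ^ 2 := by
    apply pd_eq_of_hasDerivAt
    simpa using (Real.hasDerivAt_cos (x 2)).fun_div (Real.hasDerivAt_sin (x 2)) hs
  simp only [ricci, h.pd_christoffel hx, h.christoffel_eq hx, Fin.sum_univ_four]
  delta staticGamma
  simp [pd_const, pd_one_radial (fun r => -(r / w r)), h1, h2]
  field_simp
  ring

lemma ricci_three_three {y w : ℝ → ℝ} {I : Set ℝ} (h : IsRegularOn y w I) {x : Fin 4 → ℝ}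
    (hx : x ∈ region I) :
    ricci (metric y w) 3 3 x = Real.sin (x 2) ^ 2 *
      (1 - 1 / w (x 1) + x 1 * deriv w (x 1) / (2 * w (x 1) ^ 2)
        - x 1 * deriv y (x 1) / (2 * y (x 1) * w (x 1))) := by
  have hy := (h.y_pos _ hx.1).ne'
  have hw := (h.w_pos _ hx.1).ne'
  have hr := (h.pos _ hx.1).ne'
  have hs := (sin_pos_of_mem_region hx).ne'
  have h1 : pd 1 (fun z => -(z 1 / w (z 1) * Real.sin (z 2) ^ 2)) x =
      -((w (x 1) - x 1 * deriv w (x 1)) / w (x 1) ^ 2 * Real.sin (x 2) ^ 2) := by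
    apply pd_eq_of_hasDerivAt
    simpa using (((hasDerivAt_id' (x 1)).fun_div (h.w_diff hx.1).hasDerivAt hw).mul_const
      (Real.sin (x 2) ^ 2)).fun_neg
  have h2 : pd 2 (fun z => -(Real.sin (z 2) * Real.cos (z 2))) x =
      -(Real.cos (x 2) * Real.cos (x 2) + Real.sin (x 2) * -Real.sin (x 2)) := by
    apply pd_eq_of_hasDerivAt
    simpa using ((Real.hasDerivAt_sin (x 2)).fun_mul (Real.hasDerivAt_cos (x 2))).fun_neg
  simp only [ricci, h.pd_christoffel hx, h.christoffel_eq hx, Fin.sum_univ_four]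
  delta staticGamma
  simp [pd_const, h1, h2]
  field_simp
  ring

lemma metricTrace_metric {y w : ℝ → ℝ} {I : Set ℝ} (h : IsRegularOn y w I) {x : Fin 4 → ℝ}
    (hx : x ∈ region I) (S : Tensor2) :
    metricTrace (metric y w) S x = -(y (x 1))⁻¹ * S x 0 0 + (w (x 1))⁻¹ * S x 1 1
      + (x 1 ^ 2)⁻¹ * S x 2 2 + (x 1 ^ 2 * Real.sin (x 2) ^ 2)⁻¹ * S x 3 3 := by
  rw [metricTrace, metric_inv (h.y_pos _ hx.1).ne' (h.w_pos _ hx.1).ne' (h.pos _ hx.1).ne'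
    (sin_pos_of_mem_region hx).ne']
  simp [Fin.sum_univ_four, Matrix.diagonal]

/-- All second derivatives cancel in `G_{rr}`, so the radial field equation is of first order. -/
lemma einstein_one_one {y w : ℝ → ℝ} {I : Set ℝ} (h : IsRegularOn y w I) {x : Fin 4 → ℝ}
    (hx : x ∈ region I) :
    einstein (metric y w) x 1 1 = w (x 1) *
      (deriv y (x 1) / (x 1 * y (x 1) * w (x 1)) + (1 / w (x 1) - 1) / x 1 ^ 2) := by
  have hy := (h.y_pos _ hx.1).ne'
  have hw := (h.w_pos _ hx.1).ne'
  have hr := (h.pos _ hx.1).ne'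
  have hs := (sin_pos_of_mem_region hx).ne'
  have hg : metric y w x 1 1 = w (x 1) := by simp [metric]
  have ht := metricTrace_metric h hx (fun z i j => ricci (metric y w) i j z)
  simp only [einstein, ht, hg, ricci_zero_zero h hx, ricci_one_one h hx, ricci_two_two h hx,
    ricci_three_three h hx]
  field_simp
  ring

/-! ### The radial field equation -/

lemma darkTensor_eq {y w A B C : ℝ → ℝ} {x : Fin 4 → ℝ} (hy : 0 < y (x 1)) (hw : 0 < w (x 1)) :
    darkTensor y w A B C x = fun k l => Matrix.diagonal
      ![(A (x 1) - B (x 1)) * y (x 1), (B (x 1) + C (x 1)) * w (x 1), B (x 1) * x 1 ^ 2,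
        B (x 1) * (x 1 ^ 2 * Real.sin (x 2) ^ 2)] k l := by
  have h1 := Real.mul_self_sqrt hy.le
  have h2 := Real.mul_self_sqrt hw.le
  funext k l
  fin_cases k <;> fin_cases l <;>
    simp [darkTensor, metric, velocity, normal, Matrix.diagonal, mul_assoc, h1, h2] <;> ring

/-- The base point over the radius `r` at which the tensor equations are evaluated: it lies on the
equator, where `sin θ = 1`. -/
noncomputable def equatorPoint (r : ℝ) : Fin 4 → ℝ := ![0, r, Real.pi / 2, 0]

lemma equatorPoint_mem_region {I : Set ℝ} {r : ℝ} (hr : r ∈ I) : equatorPoint r ∈ region I :=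
  ⟨hr, by constructor <;> simp [equatorPoint] <;> linarith [Real.pi_pos]⟩

/-- The radial vacuum field equation: `G^r_r` is the radial dark pressure. -/
lemma radial_field_vacuum {y w A B C : ℝ → ℝ} {I : Set ℝ} (h : IsRegularOn y w I)
    (hE : ∀ x ∈ region I, einstein (metric y w) x = darkTensor y w A B C x) {r : ℝ} (hr : r ∈ I) :
    deriv y r / (r * y r * w r) + (1 / w r - 1) / r ^ 2 = darkRadialPressure B C r := by
  have hx := equatorPoint_mem_region hr
  have e := congrFun (congrFun (hE _ hx) 1) 1
  rw [einstein_one_one h hx, darkTensor_eq (h.y_pos _ hx.1) (h.w_pos _ hx.1)] at e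
  have hw := (h.w_pos _ hr).ne'
  simp [equatorPoint] at e
  rw [darkRadialPressure]
  apply mul_left_cancel₀ hw
  simp only [one_div]
  linarith

/-- The radial field equation with a fluid: `G^r_r` is the sum of the two radial pressures. -/
lemma radial_field_fluid {y w μ pr pt A B C : ℝ → ℝ} {I : Set ℝ} (h : IsRegularOn y w I)
    (hE : ∀ x ∈ region I, einstein (metric y w) x =
      fluidTensor y w μ pr pt x + darkTensor y w A B C x) {r : ℝ} (hr : r ∈ I) :
    deriv y r / (r * y r * w r) + (1 / w r - 1) / r ^ 2 = pr r + darkRadialPressure B C r := by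
  have hx := equatorPoint_mem_region hr
  have e : einstein (metric y w) (equatorPoint r) 1 1 =
      fluidTensor y w μ pr pt (equatorPoint r) 1 1 + darkTensor y w A B C (equatorPoint r) 1 1 :=
    congrFun (congrFun (hE _ hx) 1) 1
  rw [einstein_one_one h hx, darkTensor_eq (h.y_pos _ hx.1) (h.w_pos _ hx.1)] at e
  have hw := (h.w_pos _ hr).ne'
  have h2 := Real.mul_self_sqrt (h.w_pos _ hr).le
  simp [equatorPoint, fluidTensor, metric, velocity, normal, h2] at e
  rw [darkRadialPressure]
  apply mul_left_cancel₀ hw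
  simp only [one_div]
  linarith

/-! ### The conformal Killing equation -/

lemma metricTrace_darkTensor {y w A B C : ℝ → ℝ} {I : Set ℝ} (h : IsRegularOn y w I)
    {x : Fin 4 → ℝ} (hx : x ∈ region I) :
    metricTrace (metric y w) (darkTensor y w A B C) x = 4 * B (x 1) - A (x 1) + C (x 1) := by
  have hy := (h.y_pos _ hx.1).ne'
  have hw := (h.w_pos _ hx.1).ne'
  have hr := (h.pos _ hx.1).ne'
  have hs := (sin_pos_of_mem_region hx).ne'
  rw [metricTrace_metric h hx, darkTensor_eq (h.y_pos _ hx.1) (h.w_pos _ hx.1)]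
  simp
  field_simp
  ring

/-- The components `(r, r, r)`, `(r, t, t)` and `(r, θ, θ)` of the conformal Killing equation. -/
lemma killing_components {y w A B C : ℝ → ℝ} {I : Set ℝ} (h : IsRegularOn y w I)
    (hK : ∀ x ∈ region I, ConformalKillingAt (metric y w) (darkTensor y w A B C) x)
    {r : ℝ} (hr : r ∈ I) (hA : DifferentiableAt ℝ A r) (hB : DifferentiableAt ℝ B r)
    (hC : DifferentiableAt ℝ C r) :
    deriv B r + deriv C r = (4 * deriv B r - deriv A r + deriv C r) / 6 ∧
    y r * (deriv B r - deriv A r) + deriv y r * (A r + C r) =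
      y r * (4 * deriv B r - deriv A r + deriv C r) / 6 ∧
    r * deriv B r + 2 * C r = r * (4 * deriv B r - deriv A r + deriv C r) / 6 := by
  have hx := equatorPoint_mem_region hr
  set x := equatorPoint r with hxdef
  have x1 : x 1 = r := rfl
  have x2 : x 2 = Real.pi / 2 := rfl
  have hy := (h.y_pos _ hr).ne'
  have hw := (h.w_pos _ hr).ne'
  have hr0 := (h.pos _ hr).ne'
  have hnhds := (isOpen_region h.isOpen).mem_nhds hx
  have htr : ∀ i, pd i (metricTrace (metric y w) (darkTensor y w A B C)) x =
      pd i (fun z => (fun s => 4 * B s - A s + C s) (z 1)) x := fun i => pd_congr (by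
    filter_upwards [hnhds] with z hz
    exact metricTrace_darkTensor h hz)
  have hpd : ∀ i k l, pd i (fun z => darkTensor y w A B C z k l) x =
      pd i (fun z => Matrix.diagonal
      ![(A (z 1) - B (z 1)) * y (z 1), (B (z 1) + C (z 1)) * w (z 1), B (z 1) * z 1 ^ 2,
        B (z 1) * (z 1 ^ 2 * Real.sin (z 2) ^ 2)] k l) x := fun i k l => pd_congr (by
    filter_upwards [hnhds] with z hz
    exact congrFun (congrFun (darkTensor_eq (h.y_pos _ hz.1) (h.w_pos _ hz.1)) k) l)
  have d0 : deriv (fun s => 4 * B s - A s + C s) r = 4 * deriv B r - deriv A r + deriv C r :=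
    (((hB.hasDerivAt.const_mul 4).fun_sub hA.hasDerivAt).fun_add hC.hasDerivAt).deriv
  have d1 : deriv (fun s => (B s + C s) * w s) r =
      (deriv B r + deriv C r) * w r + (B r + C r) * deriv w r :=
    ((hB.hasDerivAt.fun_add hC.hasDerivAt).fun_mul (h.w_diff hr).hasDerivAt).deriv
  have d2 : deriv (fun s => (A s - B s) * y s) r =
      (deriv A r - deriv B r) * y r + (A r - B r) * deriv y r :=
    ((hA.hasDerivAt.fun_sub hB.hasDerivAt).fun_mul (h.y_diff hr).hasDerivAt).deriv
  have d3 : deriv (fun s => B s * s ^ 2) r = deriv B r * r ^ 2 + B r * (2 * r) := by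
    simpa using (hB.hasDerivAt.fun_mul (hasDerivAt_pow 2 r)).deriv
  have e1 := hK x hx 1 1 1
  have e2 := hK x hx 1 0 0
  have e3 := hK x hx 1 2 2
  simp only [covDeriv2, h.christoffel_eq hx, darkTensor_eq (h.y_pos _ hx.1) (h.w_pos _ hx.1), htr,
    hpd, Fin.sum_univ_four] at e1 e2 e3
  simp [staticGamma, metric, x1, x2, Matrix.diagonal, pd_const,
    pd_one_radial (fun s => 4 * B s - A s + C s), d0,
    pd_radial_of_ne (show (0 : Fin 4) ≠ 1 by decide) (fun s => 4 * B s - A s + C s),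
    pd_radial_of_ne (show (2 : Fin 4) ≠ 1 by decide) (fun s => 4 * B s - A s + C s),
    pd_one_radial (fun s => (B s + C s) * w s), d1,
    pd_one_radial (fun s => (A s - B s) * y s), d2,
    pd_one_radial (fun s => B s * s ^ 2), d3] at e1 e2 e3
  refine ⟨?_, ?_, ?_⟩
  · field_simp at e1
    apply mul_left_cancel₀ hw
    linarith
  · field_simp at e2 ⊢
    linarith
  · field_simp at e3 ⊢
    linarith

lemma exists_eq_const_of_deriv_zero {D : Set ℝ} (hD : Convex ℝ D) {F : ℝ → ℝ}
    (hF : ContinuousOn F D) (hF' : ∀ r ∈ interior D, HasDerivAt F 0 r) :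
    ∃ c, ∀ r ∈ D, F r = c := by
  have hd : DifferentiableOn ℝ F (interior D) := fun r hr =>
    (hF' r hr).differentiableAt.differentiableWithinAt
  have hm := monotoneOn_of_deriv_nonneg hD hF hd fun r hr => (hF' r hr).deriv.ge
  have ha := antitoneOn_of_deriv_nonpos hD hF hd fun r hr => (hF' r hr).deriv.le
  rcases D.eq_empty_or_nonempty with rfl | ⟨r₀, h₀⟩
  · exact ⟨0, by simp⟩
  · refine ⟨F r₀, fun r hr => ?_⟩
    rcases le_total r r₀ with h | h
    · exact le_antisymm (hm hr h₀ h) (ha hr h₀ h)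
    · exact le_antisymm (ha h₀ hr h) (hm h₀ hr h)

/-- The radial dark pressure of a conformal Killing tensor of the anisotropic form. The Killing
equation makes `C / r²`, `(A + C) / y` and `2 (B + C) + (A + C) + 2 C` first integrals, and these determine
the dark pressure `B + C`. -/
lemma darkRadialPressure_eq {y w A B C : ℝ → ℝ} {D : Set ℝ} (hD : Convex ℝ D)
    (hpos : ∀ r ∈ D, 0 < r) (hy : ∀ r ∈ D, y r ≠ 0) (hyc : ContinuousOn y D)
    (hA : ContDiffOn ℝ 1 A D) (hB : ContDiffOn ℝ 1 B D) (hC : ContDiffOn ℝ 1 C D)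
    (h : IsRegularOn y w (interior D))
    (hK : ∀ x ∈ region (interior D), ConformalKillingAt (metric y w) (darkTensor y w A B C) x) :
    ∃ κ₁ κ₂ κ₃ : ℝ, ∀ r ∈ D, darkRadialPressure B C r = κ₁ + κ₂ * r ^ 2 + κ₃ * y r := by
  have key : ∀ r ∈ interior D, ∃ A' B' C' : ℝ, HasDerivAt A A' r ∧ HasDerivAt B B' r ∧
      HasDerivAt C C' r ∧ B' + C' = (4 * B' - A' + C') / 6 ∧
      y r * (B' - A') + deriv y r * (A r + C r) = y r * (4 * B' - A' + C') / 6 ∧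
      r * B' + 2 * C r = r * (4 * B' - A' + C') / 6 := by
    intro r hr
    have hn : D ∈ 𝓝 r := mem_interior_iff_mem_nhds.mp hr
    have dA := (hA.contDiffAt hn).differentiableAt one_ne_zero
    have dB := (hB.contDiffAt hn).differentiableAt one_ne_zero
    have dC := (hC.contDiffAt hn).differentiableAt one_ne_zero
    exact ⟨_, _, _, dA.hasDerivAt, dB.hasDerivAt, dC.hasDerivAt,
      killing_components h hK hr dA dB dC⟩
  obtain ⟨c₂, h₂⟩ := exists_eq_const_of_deriv_zero hD (F := fun r => C r / r ^ 2)
    (hC.continuousOn.div (by fun_prop) fun r hr => (pow_pos (hpos r hr) 2).ne') (by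
      intro r hr
      obtain ⟨A', B', C', -, -, dC, e1, e2, e3⟩ := key r hr
      have hr0 := (h.pos r hr).ne'
      refine (dC.fun_div (hasDerivAt_pow 2 r) (pow_ne_zero 2 hr0)).congr_deriv ?_
      have : r * C' = 2 * C r := by linear_combination r * e1 - e3
      rw [div_eq_zero_iff]
      left
      push_cast
      linear_combination r * this)
  obtain ⟨c₃, h₃⟩ := exists_eq_const_of_deriv_zero hD (F := fun r => (A r + C r) / y r)
    ((hA.continuousOn.add hC.continuousOn).div hyc hy) (by
      intro r hr
      obtain ⟨A', B', C', dA, -, dC, e1, e2, e3⟩ := key r hr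
      refine ((dA.fun_add dC).fun_div (h.y_diff hr).hasDerivAt
        (h.y_pos r hr).ne').congr_deriv ?_
      rw [div_eq_zero_iff]
      left
      linear_combination y r * e1 - e2)
  obtain ⟨c₁, h₁⟩ := exists_eq_const_of_deriv_zero hD
    (F := fun r => 2 * (B r + C r) + (A r + C r) + 2 * C r) (by
      have := hA.continuousOn
      have := hB.continuousOn
      have := hC.continuousOn
      fun_prop) (by
      intro r hr
      obtain ⟨A', B', C', dA, dB, dC, e1, e2, e3⟩ := key r hr
      refine ((((dB.fun_add dC).const_mul 2).fun_add (dA.fun_add dC)).fun_add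
        (dC.const_mul 2)).congr_deriv ?_
      linear_combination 6 * e1)
  refine ⟨c₁ / 2, -c₂, -c₃ / 2, fun r hr => ?_⟩
  have i₂ : C r = c₂ * r ^ 2 := (div_eq_iff (pow_pos (hpos r hr) 2).ne').mp (h₂ r hr)
  have i₃ : A r + C r = c₃ * y r := (div_eq_iff (hy r hr)).mp (h₃ r hr)
  have i₁ := h₁ r hr
  beta_reduce at i₁
  rw [darkRadialPressure]
  linear_combination i₁ / 2 - i₂ - i₃ / 2

/-! ### One-sided limits at the junction -/

lemma continuousAcross_iff {R : ℝ} {S S' L L' : Tensor2}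
    (hS : ∀ x ∈ region {R}, ∀ k l,
      Tendsto (fun s => S (Function.update x 1 s) k l) (𝓝[<] R) (𝓝 (L x k l)))
    (hS' : ∀ x ∈ region {R}, ∀ k l,
      Tendsto (fun s => S' (Function.update x 1 s) k l) (𝓝[>] R) (𝓝 (L' x k l))) :
    ContinuousAcross R S S' ↔ ∀ x ∈ region {R}, ∀ k l, L x k l = L' x k l := by
  constructor
  · intro h x hx k l
    obtain ⟨c, hc, hc'⟩ := h x hx k l
    rw [tendsto_nhds_unique (hS x hx k l) hc, tendsto_nhds_unique (hS' x hx k l) hc']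
  · intro h x hx k l
    exact ⟨L x k l, hS x hx k l, h x hx k l ▸ hS' x hx k l⟩

lemma tendsto_diagonal_apply {F : Filter ℝ} {v : ℝ → Fin 4 → ℝ} {d : Fin 4 → ℝ}
    (h : ∀ i, Tendsto (fun s => v s i) F (𝓝 (d i))) (k l : Fin 4) :
    Tendsto (fun s => Matrix.diagonal (v s) k l) F (𝓝 (Matrix.diagonal d k l)) := by
  by_cases hkl : k = l
  · subst hkl
    simpa using h k
  · simp [Matrix.diagonal_apply_ne _ hkl, tendsto_const_nhds]

lemma tendsto_metric {y w : ℝ → ℝ} {R y₀ w₀ : ℝ} {F : Filter ℝ} (hF : F ≤ 𝓝 R)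
    (hy : Tendsto y F (𝓝 y₀)) (hw : Tendsto w F (𝓝 w₀)) (x : Fin 4 → ℝ) (k l : Fin 4) :
    Tendsto (fun s => metric y w (Function.update x 1 s) k l) F
      (𝓝 (Matrix.diagonal ![-y₀, w₀, R ^ 2, R ^ 2 * Real.sin (x 2) ^ 2] k l)) := by
  have hid : Tendsto (fun s : ℝ => s) F (𝓝 R) := hF
  refine tendsto_diagonal_apply (fun i => ?_) k l
  fin_cases i
  · simpa using hy.neg
  · simpa using hw
  · simpa using hid.pow 2
  · simpa using (hid.pow 2).mul_const (Real.sin (x 2) ^ 2)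

/-- The extrinsic curvature of the spheres `r = const`; `w'` drops out of it, because
`∂ᵣ √w = Γʳᵣᵣ √w`. -/
lemma covDeriv1_normal {y w : ℝ → ℝ} {I : Set ℝ} (h : IsRegularOn y w I) {x : Fin 4 → ℝ}
    (hx : x ∈ region I) (k l : Fin 4) :
    covDeriv1 (metric y w) (normal w) x k l = Matrix.diagonal
      ![-(deriv y (x 1) / (2 * √(w (x 1)))), 0, x 1 / √(w (x 1)),
        x 1 / √(w (x 1)) * Real.sin (x 2) ^ 2] k l := by
  have hw := h.w_pos _ hx.1
  have hq : √(w (x 1)) ≠ 0 := (Real.sqrt_pos.mpr hw).ne'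
  have hsq := Real.sq_sqrt hw.le
  have hd : deriv (fun s => √(w s)) (x 1) = deriv w (x 1) / (2 * √(w (x 1))) :=
    deriv_sqrt (h.w_diff hx.1) hw.ne'
  have hpd : ∀ i j, pd i (fun z => normal w z j) x =
      if i = 1 ∧ j = 1 then deriv w (x 1) / (2 * √(w (x 1))) else 0 := by
    intro i j
    fin_cases j
    · simp [normal, pd_const]
    · by_cases hi : i = 1
      · subst hi
        simp [normal, pd_one_radial (fun s => √(w s)), hd]
      · simp [normal, pd_radial_of_ne hi (fun s => √(w s)), hi]
    · simp [normal, pd_const]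
    · simp [normal, pd_const]
  have hχ : ∀ m, normal w x m = (![0, √(w (x 1)), 0, 0] : Fin 4 → ℝ) m := fun _ => rfl
  simp only [covDeriv1, hpd, hχ, h.christoffel_eq hx, Fin.sum_univ_four]
  -- every surviving symbol carries one factor `1 / w = 1 / (√w)²`
  generalize √(w (x 1)) = q at hq hsq
  fin_cases k <;> fin_cases l <;>
    simp [staticGamma, Matrix.diagonal, ← hsq] <;> (field_simp; try ring)

lemma tendsto_covDeriv1_normal {y w : ℝ → ℝ} {R y₁ w₀ : ℝ} {F : Filter ℝ} (hF : F ≤ 𝓝 R)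
    {I : Set ℝ} (h : IsRegularOn y w I) (hI : I ∈ F) (hy : Tendsto (deriv y) F (𝓝 y₁))
    (hw : Tendsto w F (𝓝 w₀)) (hw₀ : 0 < w₀) {x : Fin 4 → ℝ} (hx : x ∈ region {R}) (k l : Fin 4) :
    Tendsto (fun s => covDeriv1 (metric y w) (normal w) (Function.update x 1 s) k l) F
      (𝓝 (Matrix.diagonal ![-(y₁ / (2 * √w₀)), 0, R / √w₀, R / √w₀ * Real.sin (x 2) ^ 2] k l)) := by
  have hid : Tendsto (fun s : ℝ => s) F (𝓝 R) := hF
  have hq := hw.sqrt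
  have hq₀ : √w₀ ≠ 0 := (Real.sqrt_pos.mpr hw₀).ne'
  have hdiv : Tendsto (fun s => s / √(w s)) F (𝓝 (R / √w₀)) := hid.div hq hq₀
  have hlim := tendsto_diagonal_apply (F := F)
    (v := fun s => ![-(deriv y s / (2 * √(w s))), 0, s / √(w s), s / √(w s) * Real.sin (x 2) ^ 2])
    (d := ![-(y₁ / (2 * √w₀)), 0, R / √w₀, R / √w₀ * Real.sin (x 2) ^ 2]) (by
      intro i
      fin_cases i
      · simpa using (hy.div (hq.const_mul 2) (mul_ne_zero two_ne_zero hq₀)).neg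
      · simp [tendsto_const_nhds]
      · simpa using hdiv
      · simpa using hdiv.mul_const (Real.sin (x 2) ^ 2)) k l
  refine hlim.congr' ?_
  filter_upwards [hI] with s hs
  have hz : Function.update x 1 s ∈ region I := ⟨by simpa using hs, by simpa using hx.2⟩
  rw [covDeriv1_normal h hz]
  simp

/-- Applied with `R` an end point of the interval `D`, this is the one-sided limit of `g_{tt}'`. -/
lemma exists_tendsto_deriv_sq {b : ℝ → ℝ} {D : Set ℝ} {R : ℝ} (hD : Convex ℝ D)
    (hne : (interior D).Nonempty) (hb : ContDiffOn ℝ 2 b D) (hR : R ∈ D) :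
    ∃ y₁, Tendsto (deriv fun r => b r ^ 2) (𝓝[interior D] R) (𝓝 y₁) := by
  have hu : UniqueDiffOn ℝ D := uniqueDiffOn_convex hD hne
  have hy : ContDiffOn ℝ 2 (fun r => b r ^ 2) D := hb.pow 2
  have hc := hy.continuousOn_derivWithin hu (by norm_num)
  refine ⟨_, ((hc R hR).mono interior_subset).tendsto.congr' ?_⟩
  filter_upwards [self_mem_nhdsWithin] with r hr
  exact derivWithin_of_mem_nhds (mem_interior_iff_mem_nhds.mp hr)

/-- The limit of the first-order radial field equation at the junction. -/
lemma radial_field_limit {y w p : ℝ → ℝ} {R y₀ w₀ y₁ p₀ : ℝ} {F : Filter ℝ} [F.NeBot]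
    (hF : F ≤ 𝓝 R) {I : Set ℝ} (hI : I ∈ F)
    (hp : ∀ r ∈ I, deriv y r / (r * y r * w r) + (1 / w r - 1) / r ^ 2 = p r)
    (hy : Tendsto y F (𝓝 y₀)) (hw : Tendsto w F (𝓝 w₀)) (hy' : Tendsto (deriv y) F (𝓝 y₁))
    (hp' : Tendsto p F (𝓝 p₀)) (hR : R ≠ 0) (hy₀ : y₀ ≠ 0) (hw₀ : w₀ ≠ 0) :
    y₁ / (R * y₀ * w₀) + (1 / w₀ - 1) / R ^ 2 = p₀ := by
  have hid : Tendsto (fun s : ℝ => s) F (𝓝 R) := hF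
  have h1 := (hy'.div ((hid.mul hy).mul hw) (by positivity)).add
    ((((tendsto_const_nhds (x := (1 : ℝ))).div hw hw₀).sub_const 1).div (hid.pow 2) (by positivity))
  refine tendsto_nhds_unique h1 (hp'.congr' ?_)
  filter_upwards [hI] with r hr
  exact (hp r hr).symm

lemma metricContinuous_iff {R : ℝ} {y w y' w' : ℝ → ℝ} {y₀ w₀ y₀' w₀' : ℝ}
    (hy : Tendsto y (𝓝[<] R) (𝓝 y₀)) (hw : Tendsto w (𝓝[<] R) (𝓝 w₀))
    (hy' : Tendsto y' (𝓝[>] R) (𝓝 y₀')) (hw' : Tendsto w' (𝓝[>] R) (𝓝 w₀')) :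
    ContinuousAcross R (metric y w) (metric y' w') ↔ y₀ = y₀' ∧ w₀ = w₀' := by
  rw [continuousAcross_iff
    (L := fun x k l => Matrix.diagonal ![-y₀, w₀, R ^ 2, R ^ 2 * Real.sin (x 2) ^ 2] k l)
    (L' := fun x k l => Matrix.diagonal ![-y₀', w₀', R ^ 2, R ^ 2 * Real.sin (x 2) ^ 2] k l)
    (fun x _ k l => tendsto_metric nhdsWithin_le_nhds hy hw x k l)
    (fun x _ k l => tendsto_metric nhdsWithin_le_nhds hy' hw' x k l)]
  constructor
  · intro h
    have hx := equatorPoint_mem_region (mem_singleton R)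
    exact ⟨by simpa using h _ hx 0 0, by simpa using h _ hx 1 1⟩
  · rintro ⟨rfl, rfl⟩ x - k l
    rfl

/-- Across a continuous metric, the extrinsic curvature of the spheres is continuous exactly when
the derivative of `g_{tt}` is. -/
lemma extrinsicCurvature_continuous_iff {R : ℝ} {y w y' w' : ℝ → ℝ} {y₁ w₀ y₁' : ℝ} {I I' : Set ℝ}
    (h : IsRegularOn y w I) (hI : I ∈ 𝓝[<] R) (h' : IsRegularOn y' w' I') (hI' : I' ∈ 𝓝[>] R)
    (hy : Tendsto (deriv y) (𝓝[<] R) (𝓝 y₁)) (hw : Tendsto w (𝓝[<] R) (𝓝 w₀))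
    (hy' : Tendsto (deriv y') (𝓝[>] R) (𝓝 y₁')) (hw' : Tendsto w' (𝓝[>] R) (𝓝 w₀))
    (hw₀ : 0 < w₀) :
    ContinuousAcross R (covDeriv1 (metric y w) (normal w)) (covDeriv1 (metric y' w') (normal w')) ↔
      y₁ = y₁' := by
  have hq₀ : √w₀ ≠ 0 := (Real.sqrt_pos.mpr hw₀).ne'
  rw [continuousAcross_iff
    (L := fun x k l => Matrix.diagonal
      ![-(y₁ / (2 * √w₀)), 0, R / √w₀, R / √w₀ * Real.sin (x 2) ^ 2] k l)
    (L' := fun x k l => Matrix.diagonal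
      ![-(y₁' / (2 * √w₀)), 0, R / √w₀, R / √w₀ * Real.sin (x 2) ^ 2] k l)
    (fun x hx k l => tendsto_covDeriv1_normal nhdsWithin_le_nhds h hI hy hw hw₀ hx k l)
    (fun x hx k l => tendsto_covDeriv1_normal nhdsWithin_le_nhds h' hI' hy' hw' hw₀ hx k l)]
  constructor
  · intro h
    have h0 := h _ (equatorPoint_mem_region (mem_singleton R)) 0 0
    simp only [Matrix.diagonal_apply_eq, Matrix.cons_val_zero, neg_inj] at h0
    exact (div_left_inj' (mul_ne_zero two_ne_zero hq₀)).mp h0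
  · rintro rfl x - k l
    rfl

/-! ### The two sides of the junction -/

lemma IsFluidSphere.massCoeff_smooth {R : ℝ} {b M μ pr pt A B C : ℝ → ℝ}
    (h : IsFluidSphere R b M μ pr pt A B C) : ContDiffOn ℝ 2 (massCoeff M) (Ioc 0 R) :=
  (contDiffOn_const.sub ((contDiffOn_const.mul h.M_smooth).div contDiffOn_id
    fun _ hr => hr.1.ne')).inv fun r hr => (h.M_lt r hr).ne'

lemma IsFluidSphere.isRegularOn {R : ℝ} {b M μ pr pt A B C : ℝ → ℝ}
    (h : IsFluidSphere R b M μ pr pt A B C) :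
    IsRegularOn (fun r => b r ^ 2) (massCoeff M) (Ioo 0 R) where
  isOpen := isOpen_Ioo
  pos _ hr := hr.1
  y_pos r hr := by
    have := h.b_ne r (Ioo_subset_Ioc_self hr)
    positivity
  w_pos r hr := inv_pos.mpr (h.M_lt r (Ioo_subset_Ioc_self hr))
  y_smooth := (h.b_smooth.mono Ioo_subset_Ioc_self).pow 2
  w_smooth := (h.massCoeff_smooth.mono Ioo_subset_Ioc_self).of_le (by norm_num)

lemma IsVacuumExterior.isRegularOn {R R₁ : ℝ} {b f A B C : ℝ → ℝ} (hR : 0 < R)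
    (h : IsVacuumExterior R R₁ b f A B C) :
    IsRegularOn (fun r => b r ^ 2) (fun r => f r ^ 2) (Ioo R R₁) where
  isOpen := isOpen_Ioo
  pos _ hr := hR.trans hr.1
  y_pos r hr := by
    have := h.b_ne r (Ioo_subset_Ico_self hr)
    positivity
  w_pos r hr := by
    have := h.f_ne r (Ioo_subset_Ico_self hr)
    positivity
  y_smooth := (h.b_smooth.mono Ioo_subset_Ico_self).pow 2
  w_smooth := ((h.f_smooth.mono Ioo_subset_Ico_self).pow 2).of_le (by norm_num)

end CKG

open CKG in
theorem mainTheorem2 {R R₁ : ℝ} (hR : 0 < R) (hR₁ : R < R₁)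
    (bi M μm pmr pmt Ai Bi Ci : ℝ → ℝ) (be f Ae Be Ce : ℝ → ℝ)
    (hin : CKG.IsFluidSphere R bi M μm pmr pmt Ai Bi Ci)
    (hout : CKG.IsVacuumExterior R R₁ be f Ae Be Ce) :
    (CKG.MetricContinuous R bi M be f ↔
      bi R ^ 2 = be R ^ 2 ∧ 1 - 2 * M R / R = 1 / f R ^ 2) ∧
    (CKG.MetricContinuous R bi M be f →
      (CKG.ExtrinsicCurvatureContinuous R bi M be f ↔
        pmr R = CKG.darkRadialPressure Be Ce R - CKG.darkRadialPressure Bi Ci R)) ∧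
    (∃ κ₁ κ₂ κ₃ : ℝ, ∀ r ∈ Set.Ioc 0 R,
      CKG.darkRadialPressure Bi Ci r = κ₁ + κ₂ * r ^ 2 + κ₃ * bi r ^ 2) ∧
    (∃ κ₁ κ₂ κ₃ : ℝ, ∀ r ∈ Set.Ico R R₁,
      CKG.darkRadialPressure Be Ce r = κ₁ + κ₂ * r ^ 2 + κ₃ * be r ^ 2) := by
  have memi : R ∈ Ioc 0 R := ⟨hR, le_rfl⟩
  have meme : R ∈ Ico R R₁ := ⟨le_rfl, hR₁⟩
  have toi : ∀ {F : ℝ → ℝ}, ContinuousOn F (Ioc 0 R) → Tendsto F (𝓝[<] R) (𝓝 (F R)) := fun hF => by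
    rw [← nhdsWithin_Ioo_eq_nhdsLT hR]
    exact (hF R memi).mono Ioo_subset_Ioc_self
  have toe : ∀ {F : ℝ → ℝ}, ContinuousOn F (Ico R R₁) → Tendsto F (𝓝[>] R) (𝓝 (F R)) := fun hF => by
    rw [← nhdsWithin_Ioo_eq_nhdsGT hR₁]
    exact (hF R meme).mono Ioo_subset_Ico_self
  have Iin : Ioo 0 R ∈ 𝓝[<] R := Ioo_mem_nhdsLT hR
  have Iout : Ioo R R₁ ∈ 𝓝[>] R := Ioo_mem_nhdsGT hR₁
  have yi : Tendsto (fun r => bi r ^ 2) (𝓝[<] R) (𝓝 (bi R ^ 2)) :=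
    toi (hin.b_smooth.continuousOn.pow 2)
  have ye : Tendsto (fun r => be r ^ 2) (𝓝[>] R) (𝓝 (be R ^ 2)) :=
    toe (hout.b_smooth.continuousOn.pow 2)
  have wi := toi hin.massCoeff_smooth.continuousOn
  have we : Tendsto (fun r => f r ^ 2) (𝓝[>] R) (𝓝 (f R ^ 2)) :=
    toe (hout.f_smooth.continuousOn.pow 2)
  have hbi := hin.b_ne R memi
  have hbe := hout.b_ne R meme
  have hfe := hout.f_ne R meme
  have hwi : 0 < massCoeff M R := inv_pos.mpr (hin.M_lt R memi)
  have hmet : MetricContinuous R bi M be f ↔ bi R ^ 2 = be R ^ 2 ∧ massCoeff M R = f R ^ 2 :=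
    metricContinuous_iff yi wi ye we
  refine ⟨?_, fun hm => ?_, ?_, ?_⟩
  · rw [hmet, massCoeff, one_div, inv_eq_iff_eq_inv]
  · obtain ⟨hb, hf⟩ := hmet.mp hm
    obtain ⟨y₁, hy₁⟩ := exists_tendsto_deriv_sq (convex_Ioc 0 R) (by simpa using hR)
      hin.b_smooth memi
    obtain ⟨y₁', hy₁'⟩ := exists_tendsto_deriv_sq (convex_Ico R R₁) (by simpa using hR₁)
      hout.b_smooth meme
    rw [interior_Ioc, nhdsWithin_Ioo_eq_nhdsLT hR] at hy₁
    rw [interior_Ico, nhdsWithin_Ioo_eq_nhdsGT hR₁] at hy₁'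
    have limi := radial_field_limit nhdsWithin_le_nhds Iin
      (fun r hr => radial_field_fluid hin.isRegularOn hin.field hr) yi wi hy₁
      (toi (hin.pr_cont.add (hin.B_smooth.continuousOn.add hin.C_smooth.continuousOn)))
      hR.ne' (pow_ne_zero 2 hbi) hwi.ne'
    have lime := radial_field_limit nhdsWithin_le_nhds Iout
      (fun r hr => radial_field_vacuum (hout.isRegularOn hR) hout.field hr) ye we hy₁'
      (toe (hout.B_smooth.continuousOn.add hout.C_smooth.continuousOn))
      hR.ne' (pow_ne_zero 2 hbe) (pow_ne_zero 2 hfe)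
    have hext : ExtrinsicCurvatureContinuous R bi M be f ↔ y₁ = y₁' :=
      extrinsicCurvature_continuous_iff hin.isRegularOn Iin (hout.isRegularOn hR) Iout hy₁ wi hy₁'
        (hf ▸ we) hwi
    -- with equal metric limits, the field equations differ only by the derivative of `g_{tt}`
    have hcoef : R * be R ^ 2 * f R ^ 2 ≠ 0 := by positivity
    rw [hb, hf] at limi
    rw [hext, ← div_left_inj' hcoef]
    constructor <;> intro h <;> linarith
  · refine darkRadialPressure_eq (convex_Ioc 0 R) (fun r hr => hr.1)
      (fun r hr => pow_ne_zero 2 (hin.b_ne r hr)) (hin.b_smooth.continuousOn.pow 2)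
      hin.A_smooth hin.B_smooth hin.C_smooth (w := massCoeff M) ?_ ?_ <;> rw [interior_Ioc]
    exacts [hin.isRegularOn, hin.killing]
  · refine darkRadialPressure_eq (convex_Ico R R₁) (fun r hr => hR.trans_le hr.1)
      (fun r hr => pow_ne_zero 2 (hout.b_ne r hr)) (hout.b_smooth.continuousOn.pow 2)
      hout.A_smooth hout.B_smooth hout.C_smooth (w := fun r => f r ^ 2) ?_ ?_ <;>
      rw [interior_Ico]
    exacts [hout.isRegularOn hR, hout.killing]
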